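/- Let $\Sigma$ be a compact oriented surface, possibly disconnected and possibly with boundary, and let $L\subset\Sigma\times I$ be a framed oriented link with at least one component, all of whose components are labeled by $1\in\mathbb Z$. Let $D$ be a diagram of $L$ on $\Sigma$, the framing being parallel to $\Sigma$. The polynomials of $L$ are given by the following state sums over the diagram $D$. A state $S$ of $D$ is a choice of the $A$- or the $B$-smoothing at each crossing; let $a(S)$ and $b(S)$ be the numbers of crossings with an $A$- and with a $B$-smoothing, and let $b_0(S)$ be the number of components (loops) $C$ of $S$. (The $A$-smoothing joins the two regions swept out when the overstrand is rotated counterclockwise.) *Homological arrow polynomial.* Let $L_1,\dots,L_n$ be the components of $L$, let $\pi:\Sigma\times I\to\Sigma$ be the projection, and let $h_L:H_1(\Sigma)\to\mathbb Z$, $h_L(\alpha)=\sum_{i=1}^n\pi_*([L_i])\cdot\alpha$, where $\cdot$ is the algebraic intersection number. Then $$\mathcal A(L)=\sum_S A^{a(S)-b(S)}\prod_{C\subseteq S}(-A^2-A^{-2})\,X_{\pm h_L([C])}\ \in\ R_1=\mathbb Z[A^{\pm1}][X_{\pm m}\mid m\in\mathbb Z]/(X_0-1)=\mathbb Z[A^{\pm1},X_0,X_1,X_2,\dots]/(X_0-1),$$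 where the loops $C$ are given arbitrary orientations and $X_{\pm m}=X_{|m|}$. *Dye–Kauffman arrow polynomial.* Whenever a smoothing joins two half-edges at a crossing that are both oriented towards the crossing or both oriented away from it, the resulting arc of the state has a cusp, whose acute angle is the sector between these two adjacent half-edges. Two cusps that are consecutive along a loop and have their acute angles on the same side of the loop cancel. Let $\gamma(C)$ be the number of cusps that remain on the loop $C$ after as many cancelations as possible. Then $$\langle L\rangle_{\mathrm A}=\sum_S A^{a(S)-b(S)}(-A^2-A^{-2})^{b_0(S)-1}\prod_{C\subseteq S}K_{\gamma(C)/2}\ \in\ \mathbb Z[A^{\pm1},K_1,K_2,\dots],\qquad K_0=1.$$ Then for every state $S$ of $D$ and every component $C$ of $S$, the integers $h_L([C])$ and $\gamma(C)$ are even, and $$(-A^2-A^{-2})\,\langle L\rangle_{\mathrm A}=\mathcal A(L)\big|_{X_i=K_{i/2}\text{ for all even }i\ge 0},$$ where any elements of $\mathbb Z[A^{\pm1},K_1,K_2,\dots]$ may be substituted for the variables $X_i$ with odd $i$. -/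

import Mathlib

open scoped LaurentPolynomial

noncomputable section

/-! ### Compact oriented surfaces, presented by cell decompositions -/

/-- A ribbon graph (combinatorial map).  The half-edges at a vertex `v` are `⟨v, 0⟩, ⟨v, 1⟩, …`,
listed in counterclockwise order from an arbitrary first one.  Every edge `e` has a direction: its
tail half-edge is `ends (e, false)` and its head half-edge is `ends (e, true)`. -/
structure RibbonGraph where
  V : Type
  E : Type
  [fintypeV : Fintype V]
  [fintypeE : Fintype E]
  [decEqV : DecidableEq V]
  [decEqE : DecidableEq E]
  deg : V → ℕ
  ends : E × Bool ≃ (Σ v : V, Fin (deg v))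

attribute [instance] RibbonGraph.fintypeV RibbonGraph.fintypeE RibbonGraph.decEqV
  RibbonGraph.decEqE

namespace RibbonGraph

variable (Γ : RibbonGraph)

/-- Half-edges. -/
abbrev Dart : Type := Σ v : Γ.V, Fin (Γ.deg v)

variable {Γ}

/-- The edge to which a half-edge belongs. -/
def edge (d : Γ.Dart) : Γ.E := (Γ.ends.symm d).1

/-- The half-edge `d` is the tail of its edge: the edge is directed away from the vertex of `d`. -/
def IsOut (d : Γ.Dart) : Prop := (Γ.ends.symm d).2 = false

instance (d : Γ.Dart) : Decidable (IsOut d) := inferInstanceAs (Decidable (_ = _))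

/-- The other half of the same edge. -/
def flip (d : Γ.Dart) : Γ.Dart := Γ.ends ((Γ.ends.symm d).1, !(Γ.ends.symm d).2)

/-- The next half-edge counterclockwise around the same vertex. -/
def rot : Equiv.Perm Γ.Dart := Equiv.sigmaCongrRight fun v => finRotate (Γ.deg v)

/-- Leave the vertex of `d` along `d`, keeping the adjacent face on the left; `faceNext d` is the
half-edge along which the boundary of this face continues.  The faces are the orbits. -/
def faceNext (d : Γ.Dart) : Γ.Dart := rot.symm (flip d)

/-! ### Cellular chains and the intersection number -/

/-- The coefficient of the `1`-chain `a`, in the direction that leaves the vertex of `d`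
along `d`. -/
def outflow (a : Γ.E → ℤ) (d : Γ.Dart) : ℤ := if IsOut d then a (edge d) else -a (edge d)

theorem outflow_add (a a' : Γ.E → ℤ) (d : Γ.Dart) :
    outflow (a + a') d = outflow a d + outflow a' d := by
  unfold outflow
  split_ifs
  · rfl
  · simp only [Pi.add_apply]
    ring

theorem outflow_smul (r : ℤ) (a : Γ.E → ℤ) (d : Γ.Dart) :
    outflow (r • a) d = r * outflow a d := by
  unfold outflow
  split_ifs <;> simp

/-- The cellular boundary map `C₁ → C₀`. -/
def boundary₁ (Γ : RibbonGraph) : (Γ.E → ℤ) →ₗ[ℤ] (Γ.V → ℤ) where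
  toFun a v := -∑ i : Fin (Γ.deg v), outflow a ⟨v, i⟩
  map_add' a b := by
    funext v
    simp only [outflow_add, Finset.sum_add_distrib, Pi.add_apply]
    ring
  map_smul' r a := by
    funext v
    simp only [outflow_smul, Pi.smul_apply, smul_eq_mul, RingHom.id_apply, mul_neg,
      Finset.mul_sum]

/-- Cellular `1`-cycles. -/
def cycles (Γ : RibbonGraph) : Submodule ℤ (Γ.E → ℤ) := LinearMap.ker (boundary₁ Γ)

/-- The boundary map `C₂ → C₁`.  A `2`-chain is given by the function `w` whose value at `d` is the
coefficient of the face to the left of `d`. -/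
def boundary₂ (Γ : RibbonGraph) : (Γ.Dart → ℤ) →ₗ[ℤ] (Γ.E → ℤ) where
  toFun w e := w (Γ.ends (e, false)) - w (Γ.ends (e, true))
  map_add' w w' := by
    funext e
    simp only [Pi.add_apply]
    ring
  map_smul' r w := by
    funext e
    simp [mul_sub]

/-- Signed count of the crossings of (a push-off of) `a` with `b`.  Here `a` is pushed off the
graph as follows: at each of its two ends, an edge of `a` is moved to the left side, as seen when
leaving the vertex; hence it crosses `b` once along the edge, from left to right as seen in the
direction of the edge.  Near a vertex, these ends are joined by running clockwise to the half-edge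
number `i` from the sector that precedes the half-edge number `0`, which crosses the half-edges
with number `j > i`. A crossing counts `+1` if the tangent vectors of `a` and `b`, in this order,
are a positive basis. -/
def crossingNumber (a b : Γ.E → ℤ) : ℤ :=
  (∑ v : Γ.V, ∑ i : Fin (Γ.deg v), ∑ j ∈ Finset.Ioi i, outflow a ⟨v, i⟩ * outflow b ⟨v, j⟩) +
    ∑ e : Γ.E, a e * b e

theorem mem_cycles {a : Γ.E → ℤ} :
    a ∈ cycles Γ ↔ ∀ v, ∑ i : Fin (Γ.deg v), outflow a ⟨v, i⟩ = 0 := by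
  rw [cycles, LinearMap.mem_ker, funext_iff]
  simp [boundary₁]

theorem crossingNumber_add_left (a a' b : Γ.E → ℤ) :
    crossingNumber (a + a') b = crossingNumber a b + crossingNumber a' b := by
  simp only [crossingNumber, outflow_add, Finset.sum_add_distrib, Pi.add_apply, add_mul]
  ring

theorem crossingNumber_smul_left (r : ℤ) (a b : Γ.E → ℤ) :
    crossingNumber (r • a) b = r * crossingNumber a b := by
  simp only [crossingNumber, outflow_smul, Finset.mul_sum, Pi.smul_apply, smul_eq_mul,
    mul_assoc, mul_add]

theorem crossingNumber_add_right (a b b' : Γ.E → ℤ) :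
    crossingNumber a (b + b') = crossingNumber a b + crossingNumber a b' := by
  simp only [crossingNumber, outflow_add, Finset.sum_add_distrib, Pi.add_apply, mul_add]
  ring

theorem crossingNumber_smul_right (r : ℤ) (a b : Γ.E → ℤ) :
    crossingNumber a (r • b) = r * crossingNumber a b := by
  simp only [crossingNumber, outflow_smul, Finset.mul_sum, Pi.smul_apply, smul_eq_mul,
    mul_add, mul_left_comm r]

theorem sum_dart (f : Γ.Dart → ℤ) :
    ∑ v : Γ.V, ∑ i : Fin (Γ.deg v), f ⟨v, i⟩ =
      ∑ e : Γ.E, (f (Γ.ends (e, true)) + f (Γ.ends (e, false))) := by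
  rw [← Fintype.sum_sigma', ← Equiv.sum_comp Γ.ends f, Fintype.sum_prod_type]
  simp

theorem outflow_tail (a : Γ.E → ℤ) (e : Γ.E) : outflow a (Γ.ends (e, false)) = a e := by
  simp [outflow, IsOut, edge]

theorem outflow_head (a : Γ.E → ℤ) (e : Γ.E) : outflow a (Γ.ends (e, true)) = -a e := by
  simp [outflow, IsOut, edge]

theorem flip_tail (e : Γ.E) : flip (Γ.ends (e, false)) = Γ.ends (e, true) := by
  simp [flip]

theorem flip_head (e : Γ.E) : flip (Γ.ends (e, true)) = Γ.ends (e, false) := by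
  simp [flip]

theorem sum_lt_add_sum_lt {n : ℕ} (x y : Fin n → ℤ) :
    (∑ i, ∑ j ∈ Finset.Ioi i, x i * y j) + (∑ i, ∑ j ∈ Finset.Ioi i, y i * x j) +
      ∑ i, x i * y i = (∑ i, x i) * ∑ j, y j := by
  have hI : ∀ i : Fin n, Finset.Ioi i = Finset.univ.filter fun j => i < j := by
    intro i
    ext j
    simp
  simp only [hI, Finset.sum_filter]
  rw [Finset.sum_mul_sum]
  rw [Finset.sum_comm (f := fun i j : Fin n => if i < j then y i * x j else 0)]
  rw [← Finset.sum_add_distrib, ← Finset.sum_add_distrib]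
  refine Finset.sum_congr rfl fun i _ => ?_
  have h2 : x i * y i = ∑ j, if i = j then x i * y j else 0 := by
    simp
  rw [h2, ← Finset.sum_add_distrib, ← Finset.sum_add_distrib]
  refine Finset.sum_congr rfl fun j _ => ?_
  rcases lt_trichotomy i j with h | h | h
  · simp [h, h.not_gt, h.ne]
  · simp [h]
  · simp [h, h.not_gt, h.ne', mul_comm]

theorem crossingNumber_antisymm {a b : Γ.E → ℤ} (ha : a ∈ cycles Γ) :
    crossingNumber a b = -crossingNumber b a := by
  have h1 : (∑ v : Γ.V, ∑ i : Fin (Γ.deg v), ∑ j ∈ Finset.Ioi i,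
        outflow a ⟨v, i⟩ * outflow b ⟨v, j⟩) +
      (∑ v : Γ.V, ∑ i : Fin (Γ.deg v), ∑ j ∈ Finset.Ioi i,
        outflow b ⟨v, i⟩ * outflow a ⟨v, j⟩) +
      ∑ v : Γ.V, ∑ i : Fin (Γ.deg v), outflow a ⟨v, i⟩ * outflow b ⟨v, i⟩ = 0 := by
    rw [← Finset.sum_add_distrib, ← Finset.sum_add_distrib]
    refine Finset.sum_eq_zero fun v _ => ?_
    rw [sum_lt_add_sum_lt (fun i => outflow a ⟨v, i⟩) (fun i => outflow b ⟨v, i⟩),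
      mem_cycles.1 ha v, zero_mul]
  have h2 := sum_dart fun d : Γ.Dart => outflow a d * outflow b d
  simp only [outflow_tail, outflow_head, neg_mul_neg, Finset.sum_add_distrib] at h2
  have h3 : ∑ e : Γ.E, b e * a e = ∑ e : Γ.E, a e * b e :=
    Finset.sum_congr rfl fun e _ => mul_comm _ _
  unfold crossingNumber
  rw [h3]
  linarith

theorem outflow_boundary₂ {w : Γ.Dart → ℤ} (hw : ∀ d, w (faceNext d) = w d) (d : Γ.Dart) :
    outflow (boundary₂ Γ w) d = w d - w (rot.symm d) := by
  obtain ⟨⟨e, s⟩, rfl⟩ := Γ.ends.surjective d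
  cases s
  · have h := hw (Γ.ends (e, true))
    rw [faceNext, flip_head] at h
    rw [outflow_tail, h]
    rfl
  · have h := hw (Γ.ends (e, false))
    rw [faceNext, flip_tail] at h
    rw [outflow_head, h]
    simp [boundary₂]

theorem sum_lt_sub {m : ℕ} (u : Fin (m + 1) → ℤ) (j : Fin (m + 1)) :
    ∑ i ∈ Finset.Iio j, (u i - u ((finRotate (m + 1)).symm i)) =
      u ((finRotate (m + 1)).symm j) - u (Fin.last m) := by
  induction j using Fin.induction with
  | zero =>
    have h : (finRotate (m + 1)).symm 0 = Fin.last m := by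
      rw [Equiv.symm_apply_eq, finRotate_last]
    have h' : Finset.Iio (0 : Fin (m + 1)) = ∅ := by
      ext i
      simp
    rw [h, h', sub_self, Finset.sum_empty]
  | succ j ih =>
    have h : (finRotate (m + 1)).symm j.succ = j.castSucc := by
      rw [Equiv.symm_apply_eq, finRotate_apply, Fin.coeSucc_eq_succ]
    have h' : Finset.Iio j.succ = insert j.castSucc (Finset.Iio j.castSucc) := by
      ext i
      simp only [Finset.mem_Iio, Finset.mem_insert, Fin.lt_def, Fin.ext_iff, Fin.val_succ,
        Fin.val_castSucc]
      omega
    rw [h, h', Finset.sum_insert (by simp), ih]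
    ring

theorem sum_boundary_lt {n : ℕ} (u c : Fin n → ℤ) (hc : ∑ j, c j = 0) :
    ∑ i, ∑ j ∈ Finset.Ioi i, (u i - u ((finRotate n).symm i)) * c j =
      ∑ j, u ((finRotate n).symm j) * c j := by
  cases n with
  | zero => simp
  | succ m =>
    have h : ∑ i, ∑ j ∈ Finset.Ioi i, (u i - u ((finRotate (m + 1)).symm i)) * c j =
        ∑ j, ∑ i ∈ Finset.Iio j, (u i - u ((finRotate (m + 1)).symm i)) * c j :=
      Finset.sum_comm' (by simp)
    rw [h]
    simp only [← Finset.sum_mul, sum_lt_sub]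
    simp only [sub_mul, Finset.sum_sub_distrib]
    rw [← Finset.mul_sum, hc, mul_zero, sub_zero]

theorem crossingNumber_boundary₂_left {w : Γ.Dart → ℤ} (hw : ∀ d, w (faceNext d) = w d)
    {b : Γ.E → ℤ} (hb : b ∈ cycles Γ) : crossingNumber (boundary₂ Γ w) b = 0 := by
  have h1 : ∀ v : Γ.V, (∑ i : Fin (Γ.deg v), ∑ j ∈ Finset.Ioi i,
      outflow (boundary₂ Γ w) ⟨v, i⟩ * outflow b ⟨v, j⟩) =
      ∑ j : Fin (Γ.deg v), w (rot.symm ⟨v, j⟩) * outflow b ⟨v, j⟩ := by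
    intro v
    simp only [outflow_boundary₂ hw]
    exact sum_boundary_lt (fun i => w ⟨v, i⟩) (fun i => outflow b ⟨v, i⟩) (mem_cycles.1 hb v)
  have h4 := sum_dart fun d : Γ.Dart => w (rot.symm d) * outflow b d
  unfold crossingNumber
  simp only [h1]
  rw [h4, ← Finset.sum_add_distrib]
  refine Finset.sum_eq_zero fun e _ => ?_
  have h2 := hw (Γ.ends (e, true))
  have h3 := hw (Γ.ends (e, false))
  rw [faceNext, flip_head] at h2
  rw [faceNext, flip_tail] at h3
  rw [outflow_tail, outflow_head, h2, h3]
  simp only [boundary₂, LinearMap.coe_mk, AddHom.coe_mk]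
  ring

theorem crossingNumber_boundary₂_right {w : Γ.Dart → ℤ} (hw : ∀ d, w (faceNext d) = w d)
    {a : Γ.E → ℤ} (ha : a ∈ cycles Γ) : crossingNumber a (boundary₂ Γ w) = 0 := by
  rw [crossingNumber_antisymm ha, crossingNumber_boundary₂_left hw ha, neg_zero]

/-- The crossing number as a bilinear form. -/
def crossingForm (Γ : RibbonGraph) : (Γ.E → ℤ) →ₗ[ℤ] (Γ.E → ℤ) →ₗ[ℤ] ℤ :=
  LinearMap.mk₂ ℤ crossingNumber crossingNumber_add_left crossingNumber_smul_left
    crossingNumber_add_right crossingNumber_smul_right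

/-- The crossing number as a bilinear form on cycles. -/
def cycleForm (Γ : RibbonGraph) : cycles Γ →ₗ[ℤ] cycles Γ →ₗ[ℤ] ℤ :=
  (crossingForm Γ).domRestrict₁₂ (cycles Γ) (cycles Γ)

end RibbonGraph

/-- A compact oriented surface, possibly disconnected and possibly with boundary, with a graph in
its interior that cuts it into disks and collars of boundary circles.  It is obtained from a ribbon
graph by gluing disks to some of the boundary circles (faces) of its thickening:
`capped d` says that the face to the left of `d` is a disk of the surface. -/
structure CellSurface extends RibbonGraph where
  capped : toRibbonGraph.Dart → Prop
  capped_faceNext : ∀ d, capped (RibbonGraph.faceNext d) ↔ capped d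

namespace CellSurface

open RibbonGraph

variable (F : CellSurface)

/-- Cellular `2`-chains: one integer for each face that is a disk of the surface. -/
def chains₂ : Submodule ℤ (F.Dart → ℤ) where
  carrier := {w | (∀ d, w (faceNext d) = w d) ∧ ∀ d, ¬ F.capped d → w d = 0}
  add_mem' := by
    rintro w w' ⟨h1, h2⟩ ⟨h1', h2'⟩
    exact ⟨fun d => by simp [h1, h1'], fun d hd => by simp [h2 d hd, h2' d hd]⟩
  zero_mem' := ⟨fun _ => rfl, fun _ _ => rfl⟩
  smul_mem' := by
    rintro r w ⟨h1, h2⟩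
    exact ⟨fun d => by simp [h1], fun d hd => by simp [h2 d hd]⟩

/-- Cellular `1`-boundaries. -/
def boundaries : Submodule ℤ (F.E → ℤ) := F.chains₂.map (boundary₂ F.toRibbonGraph)

/-- Boundaries, as a submodule of the cycles. -/
def boundariesInCycles : Submodule ℤ (cycles F.toRibbonGraph) :=
  F.boundaries.submoduleOf (cycles F.toRibbonGraph)

/-- The first homology group of the surface, with integer coefficients. -/
abbrev H₁ : Type := cycles F.toRibbonGraph ⧸ F.boundariesInCycles

/-- The algebraic intersection number on the first homology group. -/
def intersectionForm : F.H₁ →ₗ[ℤ] F.H₁ →ₗ[ℤ] ℤ :=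
  LinearMap.liftQ₂ F.boundariesInCycles F.boundariesInCycles (cycleForm F.toRibbonGraph)
    (by
      rintro a ⟨w, hw, hwa⟩
      refine LinearMap.ext fun b => ?_
      change crossingNumber (a : F.E → ℤ) (b : F.E → ℤ) = 0
      rw [show (a : F.E → ℤ) = boundary₂ F.toRibbonGraph w from hwa.symm]
      exact crossingNumber_boundary₂_left hw.1 b.2)
    (by
      rintro b ⟨w, hw, hwb⟩
      refine LinearMap.ext fun a => ?_
      change crossingNumber (a : F.E → ℤ) (b : F.E → ℤ) = 0
      rw [show (b : F.E → ℤ) = boundary₂ F.toRibbonGraph w from hwb.symm]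
      exact crossingNumber_boundary₂_right hw.1 a.2)

end CellSurface

/-! ### Link diagrams on surfaces -/

namespace RibbonGraph

variable {Γ : RibbonGraph}

/-- The edge of `d`, traversed so as to leave the vertex of `d`, as a `1`-chain. -/
def dartChain (d : Γ.Dart) : Γ.E → ℤ := Pi.single (edge d) (if IsOut d then 1 else -1)

/-- Given a rule `p` that assigns to each half-edge at which a walk may arrive at a vertex the
half-edge along which it leaves: traverse the edge of `d`, away from the vertex of `d`, and apply
the rule at its other end. -/
def walk (p : Γ.Dart → Γ.Dart) (d : Γ.Dart) : Γ.Dart := p (flip d)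

/-- The half-edges along which the closed walk that starts with `d` successively leaves the
vertices, once around. -/
def travel (p : Γ.Dart → Γ.Dart) (d : Γ.Dart) : List Γ.Dart :=
  (List.range (Function.minimalPeriod (walk p) d)).map fun k => (walk p)^[k] d

/-- The `1`-chain that runs once around the closed walk that starts with `d`. -/
def travelChain (p : Γ.Dart → Γ.Dart) (d : Γ.Dart) : Γ.E → ℤ :=
  ((travel p d).map dartChain).sum

theorem sum_outflow_dartChain (d : Γ.Dart) (v : Γ.V) :
    ∑ i : Fin (Γ.deg v), outflow (dartChain d) ⟨v, i⟩ =
      (if d.1 = v then 1 else 0) - (if (flip d).1 = v then 1 else 0) := by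
  have h1 : ∀ d' : Γ.Dart, outflow (dartChain d) d' =
      (if d' = d then 1 else 0) - (if d' = flip d then 1 else 0) := by
    intro d'
    obtain ⟨⟨e, s⟩, rfl⟩ := Γ.ends.surjective d
    obtain ⟨⟨e', s'⟩, rfl⟩ := Γ.ends.surjective d'
    by_cases h : e' = e <;> cases s <;> cases s' <;>
      simp [outflow, dartChain, edge, IsOut, flip, Pi.single_apply, h]
  have h2 : ∀ c : Γ.Dart, ∑ i : Fin (Γ.deg v), (if (⟨v, i⟩ : Γ.Dart) = c then (1 : ℤ) else 0) =
      if c.1 = v then 1 else 0 := by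
    rintro ⟨w, j⟩
    by_cases h : w = v
    · subst h
      simp
    · have h' : ∀ i : Fin (Γ.deg v), (⟨v, i⟩ : Γ.Dart) ≠ ⟨w, j⟩ := fun i hi =>
        h (congrArg Sigma.fst hi).symm
      simp [h, h']
  simp only [h1, Finset.sum_sub_distrib, h2]

theorem boundary₁_dartChain (d : Γ.Dart) :
    boundary₁ Γ (dartChain d) = Pi.single (flip d).1 1 - Pi.single d.1 1 := by
  funext v
  change -∑ i : Fin (Γ.deg v), outflow (dartChain d) ⟨v, i⟩ = _
  rw [sum_outflow_dartChain]
  simp [Pi.single_apply, eq_comm]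

theorem travelChain_mem (p : Γ.Dart → Γ.Dart) (hp : ∀ d, (p d).1 = d.1) (d : Γ.Dart) :
    travelChain p d ∈ cycles Γ := by
  have h : ∀ n : ℕ, boundary₁ Γ
      (((List.range n).map fun k => dartChain ((walk p)^[k] d)).sum) =
      Pi.single ((walk p)^[n] d).1 1 - Pi.single d.1 1 := by
    intro n
    induction n with
    | zero => simp
    | succ n ih =>
      rw [List.range_succ, List.map_append, List.sum_append, map_add, ih]
      simp only [List.map_cons, List.map_nil, List.sum_cons, List.sum_nil, add_zero]
      rw [boundary₁_dartChain, Function.iterate_succ_apply' (walk p) n d]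
      rw [show (walk p ((walk p)^[n] d)).1 = (flip ((walk p)^[n] d)).1 from hp _]
      abel
  have h' := h (Function.minimalPeriod (walk p) d)
  rw [Function.iterate_minimalPeriod, sub_self] at h'
  rw [cycles, LinearMap.mem_ker, travelChain, travel, List.map_map]
  exact h'

end RibbonGraph

/-- A diagram, on the surface `F`, of an oriented link in the thickened surface, framed by the
surface.  The diagram is a union of edges of the cell decomposition, whose directions are the
orientation of the link. -/
structure LinkDiagram (F : CellSurface) where
  /-- the edges that belong to the diagram -/
  link : Finset F.E
  /-- the crossings: the half-edges number `0` and `2` are the understrand, those with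
  number `1` and `3` are the overstrand -/
  crossings : Finset F.V
  deg_crossing : ∀ v ∈ crossings, F.deg v = 4
  /-- the half-edge by which the strand of `d` continues straight through the vertex of `d`
  (the half-edge `d` itself if it does not belong to the diagram) -/
  opp : F.Dart → F.Dart
  opp_vertex : ∀ d, (opp d).1 = d.1
  opp_opp : ∀ d, opp (opp d) = d
  opp_ne_iff : ∀ d, opp d ≠ d ↔ RibbonGraph.edge d ∈ link
  opp_isOut : ∀ d, RibbonGraph.edge d ∈ link →
    (RibbonGraph.IsOut (opp d) ↔ ¬ RibbonGraph.IsOut d)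
  opp_crossing : ∀ d, d.1 ∈ crossings → opp d = RibbonGraph.rot (RibbonGraph.rot d)
  /-- at most one strand passes through a vertex that is not a crossing -/
  eq_or_eq_opp : ∀ d d', d.1 ∉ crossings → d'.1 = d.1 → RibbonGraph.edge d ∈ link →
    RibbonGraph.edge d' ∈ link → d' = d ∨ d' = opp d

namespace LinkDiagram

open RibbonGraph

variable {F : CellSurface} (D : LinkDiagram F)

/-- The half-edges that belong to the diagram. -/
abbrev LinkDart : Type := {d : F.Dart // edge d ∈ D.link}

/-- The closed curves (without orientation) that consist of the edges of the diagram, joined at the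
vertices by the rule `p`. -/
def Curves (p : F.Dart → F.Dart) : Type :=
  Quot fun d d' : D.LinkDart => d'.1 = flip d.1 ∨ d'.1 = p d.1

instance (p : F.Dart → F.Dart) : Finite (D.Curves p) :=
  inferInstanceAs (Finite (Quot _))

instance (p : F.Dart → F.Dart) : Fintype (D.Curves p) := Fintype.ofFinite _

/-- The components of the link. -/
abbrev Component : Type := D.Curves D.opp

/-- The edge `e` of the diagram belongs to the component `c` of the link. -/
def InComponent (c : D.Component) (e : F.E) : Prop :=
  ∃ h : edge (F.ends (e, false)) ∈ D.link, Quot.mk _ (⟨F.ends (e, false), h⟩ : D.LinkDart) = c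

open Classical in
/-- The `1`-chain of a component of the link, with its orientation. -/
def componentChain (c : D.Component) (e : F.E) : ℤ := if D.InComponent c e then 1 else 0

theorem componentChain_mem (c : D.Component) : D.componentChain c ∈ cycles F.toRibbonGraph := by
  classical
  have key : ∀ d : F.Dart, outflow (D.componentChain c) d =
      if ∃ h : edge d ∈ D.link, Quot.mk _ (⟨d, h⟩ : D.LinkDart) = c then
        (if IsOut d then 1 else -1) else 0 := by
    intro d
    obtain ⟨⟨e, s⟩, rfl⟩ := F.ends.surjective d
    cases s
    · rw [outflow_tail, componentChain, InComponent]
      simp [IsOut]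
    · rw [outflow_head, componentChain, InComponent]
      have h : (∃ h : edge (F.ends (e, false)) ∈ D.link,
            (Quot.mk _ (⟨F.ends (e, false), h⟩ : D.LinkDart) : D.Component) = c) ↔
          ∃ h : edge (F.ends (e, true)) ∈ D.link,
            (Quot.mk _ (⟨F.ends (e, true), h⟩ : D.LinkDart) : D.Component) = c := by
        constructor
        · rintro ⟨h, hc⟩
          have h' : edge (F.ends (e, true)) ∈ D.link := by simpa [edge] using h
          refine ⟨h', ?_⟩
          rw [← hc]
          exact Quot.sound (Or.inl (flip_head e).symm)
        · rintro ⟨h, hc⟩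
          have h' : edge (F.ends (e, false)) ∈ D.link := by simpa [edge] using h
          refine ⟨h', ?_⟩
          rw [← hc]
          exact Quot.sound (Or.inl (flip_tail e).symm)
      simp only [h]
      split_ifs <;> simp_all [IsOut]
  have hopp : ∀ d : F.Dart, outflow (D.componentChain c) d +
      outflow (D.componentChain c) (D.opp d) = 0 := by
    intro d
    by_cases hd : edge d ∈ D.link
    · have hd' : edge (D.opp d) ∈ D.link := by
        rw [← D.opp_ne_iff, D.opp_opp]
        exact ((D.opp_ne_iff d).2 hd).symm
      have hq : (Quot.mk _ (⟨d, hd⟩ : D.LinkDart) : D.Component) =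
          Quot.mk _ (⟨D.opp d, hd'⟩ : D.LinkDart) := Quot.sound (Or.inr rfl)
      have ho := D.opp_isOut d hd
      rw [key, key]
      simp only [hd, hd', exists_true_left, ← hq]
      split_ifs <;> simp_all
    · have hd' : D.opp d = d := by
        by_contra h
        exact hd ((D.opp_ne_iff d).1 h)
      rw [hd', key]
      simp [hd]
  rw [mem_cycles]
  intro v
  have h1 : ∑ i : Fin (F.deg v), outflow (D.componentChain c) ⟨v, i⟩ =
      ∑ d ∈ Finset.univ.filter (fun d : F.Dart => d.1 = v), outflow (D.componentChain c) d := by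
    rw [Finset.sum_filter, Fintype.sum_sigma, Finset.sum_eq_single v]
    · simp
    · intro w _ hw
      simp [hw]
    · simp
  rw [h1]
  refine Finset.sum_involution (fun d _ => D.opp d) (fun d _ => hopp d) ?_ ?_
    (fun d _ => D.opp_opp d)
  · intro d _ hd h
    have := hopp d
    rw [h] at this
    omega
  · intro d hd
    simpa [D.opp_vertex d] using hd

/-- The homology class of the projection of a component of the link. -/
def componentClass (c : D.Component) : F.H₁ :=
  Submodule.Quotient.mk ⟨D.componentChain c, D.componentChain_mem c⟩

/-- The homomorphism from the first homology group of the surface that is given by the intersection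
numbers with the components of the link, where the component `c` is labeled by `lab c`. -/
def intersectionHom {G : Type} [AddCommGroup G] (lab : D.Component → G) (α : F.H₁) : G :=
  ∑ c : D.Component, F.intersectionForm (D.componentClass c) α • lab c

/-! ### States -/

/-- A state chooses a smoothing at each crossing: `true` is the `A`-smoothing, and `false` is the
`B`-smoothing. -/
abbrev State : Type := D.crossings → Bool

variable {D}

/-- The number of `A`-smoothings. -/
def State.a (S : D.State) : ℕ := (Finset.univ.filter fun v => S v = true).card

/-- The number of `B`-smoothings. -/
def State.b (S : D.State) : ℕ := (Finset.univ.filter fun v => S v = false).card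

/-- The half-edge that is joined to `d` at its vertex in the state `S`.  The `A`-smoothing of a
crossing joins the two regions that are swept out when the overstrand rotates counterclockwise, and
hence it joins the half-edges number `0` and `1` and those with number `2` and `3`; the
`B`-smoothing joins the half-edges number `0` and `3` and those with number `1` and `2`. -/
def State.joined (S : D.State) (d : F.Dart) : F.Dart :=
  if h : d.1 ∈ D.crossings then
    if (S ⟨d.1, h⟩ = true ↔ Even d.2.val) then rot d else rot.symm d
  else D.opp d

/-- The components of the state. -/
abbrev State.Loop (S : D.State) : Type := D.Curves S.joined

/-- A half-edge on the given component of the state, which also orients this component. -/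
def State.start (S : D.State) (C : S.Loop) : F.Dart := (Quot.out C).1

theorem State.joined_vertex (S : D.State) (d : F.Dart) : (S.joined d).1 = d.1 := by
  unfold State.joined
  split_ifs
  · rfl
  · rfl
  · exact D.opp_vertex d

/-- The homology class of a component of the state, with an arbitrary orientation. -/
def State.loopClass (S : D.State) (C : S.Loop) : F.H₁ :=
  Submodule.Quotient.mk ⟨travelChain S.joined (S.start C),
    travelChain_mem S.joined S.joined_vertex (S.start C)⟩

end LinkDiagram

/-! ### The homological arrow polynomial -/

/-- The loop value `-A² - A⁻²`, where `A` is the variable of the Laurent polynomials. -/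
def loopValue : ℤ[T;T⁻¹] := -LaurentPolynomial.T 2 - LaurentPolynomial.T (-2)

/-- Group elements up to sign. -/
def signSetoid (G : Type) [AddCommGroup G] : Setoid G where
  r g g' := g = g' ∨ g = -g'
  iseqv :=
    { refl := fun _ => Or.inl rfl
      symm := by
        rintro g g' (rfl | rfl)
        · exact Or.inl rfl
        · exact Or.inr (neg_neg g').symm
      trans := by
        rintro g g' g'' (rfl | rfl) (rfl | rfl)
        · exact Or.inl rfl
        · exact Or.inr rfl
        · exact Or.inr rfl
        · exact Or.inl (neg_neg g'') }

/-- The polynomial ring over `ℤ[A, A⁻¹]` with one variable for each `±g`. -/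
abbrev SignedPoly (G : Type) [AddCommGroup G] : Type :=
  MvPolynomial (Quotient (signSetoid G)) ℤ[T;T⁻¹]

/-- The ideal that is generated by `X₀ - 1`. -/
def zeroIdeal (G : Type) [AddCommGroup G] : Ideal (SignedPoly G) :=
  Ideal.span {MvPolynomial.X (Quotient.mk (signSetoid G) 0) - 1}

/-- The ring `ℤ[A, A⁻¹][X_{±g} | g ∈ G] / (X₀ - 1)`. -/
abbrev HomArrowRing (G : Type) [AddCommGroup G] : Type := SignedPoly G ⧸ zeroIdeal G

/-- The variable `X_{±g}`. -/
def varX {G : Type} [AddCommGroup G] (g : G) : HomArrowRing G :=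
  Ideal.Quotient.mk (zeroIdeal G) (MvPolynomial.X (Quotient.mk (signSetoid G) g))

/-- The homological arrow polynomial of a link diagram with labeled components. -/
def LinkDiagram.homArrowPoly {F : CellSurface} (D : LinkDiagram F) {G : Type} [AddCommGroup G]
    (lab : D.Component → G) : HomArrowRing G :=
  ∑ S : D.State, (LaurentPolynomial.T ((S.a : ℤ) - S.b) : ℤ[T;T⁻¹]) •
    ∏ C : S.Loop, loopValue • varX (D.intersectionHom lab (S.loopClass C))

/-- The labeling of all components by `1`. -/
def LinkDiagram.oneLabel {F : CellSurface} (D : LinkDiagram F) : D.Component → ℤ := fun _ => 1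

/-! ### The Dye-Kauffman arrow polynomial -/

namespace LinkDiagram

open RibbonGraph

variable {F : CellSurface} {D : LinkDiagram F}

/-- Where a smoothing joins two half-edges that are both directed towards the crossing or both
directed away from it, the loop gets a cusp, whose acute angle is the sector between these two
adjacent half-edges.  For someone who walks along the loop and arrives at the crossing by the
half-edge `d`, this gives the side on which the acute angle lies: `some true` if it is on the right,
`some false` if it is on the left, and `none` if there is no cusp. -/
def State.cuspAt (S : D.State) (d : F.Dart) : Option Bool :=
  if d.1 ∈ D.crossings ∧ (IsOut d ↔ IsOut (S.joined d)) then
    some (decide (S.joined d = rot d))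
  else none

/-- The cyclic sequence of the cusps along a component of the state, each given by the side of its
acute angle. -/
def State.cusps (S : D.State) (C : S.Loop) : Cycle Bool :=
  (((travel S.joined (S.start C)).filterMap fun d => S.cuspAt (flip d) : List Bool) : Cycle Bool)

end LinkDiagram

/-- Cusp cancelation: two consecutive cusps whose acute angles are on the same side of the loop are
removed. -/
def CuspCancel (c c' : Cycle Bool) : Prop :=
  ∃ (s : Bool) (l : List Bool), c = ((s :: s :: l : List Bool) : Cycle Bool) ∧
    c' = (l : Cycle Bool)

/-- The number of cusps that remain after as many cusp cancelations as possible. -/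
def reducedCusps (c : Cycle Bool) : ℕ :=
  sInf {n | ∃ c', Relation.ReflTransGen CuspCancel c c' ∧ c'.length = n}

/-- The ring `ℤ[A, A⁻¹][K₁, K₂, …]`. -/
abbrev ArrowRing : Type := MvPolynomial ℕ+ ℤ[T;T⁻¹]

/-- The variable `K_n`, where `K₀ = 1`. -/
def varK (n : ℕ) : ArrowRing := if h : 0 < n then MvPolynomial.X ⟨n, h⟩ else 1

/-- The arrow polynomial of a diagram of a link with at least one component. -/
def LinkDiagram.arrowPoly {F : CellSurface} (D : LinkDiagram F) : ArrowRing :=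
  ∑ S : D.State,
    (LaurentPolynomial.T ((S.a : ℤ) - S.b) * loopValue ^ (Fintype.card S.Loop - 1) : ℤ[T;T⁻¹]) •
      ∏ C : S.Loop, varK (reducedCusps (S.cusps C) / 2)

/-! ### The substitution -/

/-- The value of the variable `X_{±n}` under the substitution: `K_{|n|/2}` for even `n`, and the
given element `u |n|` for odd `n`. -/
def halfValue (u : ℕ → ArrowRing) (n : ℤ) : ArrowRing :=
  if Even n then varK (n.natAbs / 2) else u n.natAbs

theorem halfValue_neg (u : ℕ → ArrowRing) (n : ℤ) : halfValue u (-n) = halfValue u n := by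
  simp [halfValue]

/-- The substitution `X_i = K_{i/2}` for all even `i`; the variables with an odd index `i` are
replaced by `u i`. -/
def halfSubst (u : ℕ → ArrowRing) : HomArrowRing ℤ →ₐ[ℤ[T;T⁻¹]] ArrowRing :=
  Ideal.Quotient.liftₐ (zeroIdeal ℤ)
    (MvPolynomial.aeval fun q : Quotient (signSetoid ℤ) =>
      Quotient.lift (halfValue u)
        (by
          rintro n n' (rfl | rfl)
          · rfl
          · exact halfValue_neg u n') q)
    (by
      intro x hx
      rw [← RingHom.mem_ker]
      refine (Ideal.span_le.2 ?_ : zeroIdeal ℤ ≤ _) hx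
      rintro _ rfl
      simp [RingHom.mem_ker, halfValue, varK])

end

/-! For each loop $C$ of a state, the proof shows $|h_L([C])|=\gamma(C)$ and that this number is
even. The two state sums then agree term by term, since $-A^2-A^{-2}$ supplies the one loop factor
missing from the arrow polynomial.

Geometric half: $h_L([C])$ is the crossing number of the link cycle with the walk around $C$, and it
splits into contributions of the turns at the vertices (`crossingNumber_travelChain`). A left turn
at a crossing contributes $0$. A right turn contributes the sum of the link's outflows along its two
half-edges, which is $\pm2$ at a cusp and $0$ otherwise. Passing straight through a vertex that is
not a crossing contributes $0$. So only cusps with acute angle on the right count, each with $\pm2$.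
Every cusp, left or right, reverses the link's orientation relative to the walk, so the sign
alternates from cusp to cusp. Hence $h_L([C])=\pm2\,$`cuspSum`, and the number of cusps is even
because the orientation agrees again after one full turn (`State.iterate_walk`).

Combinatorial half: on cyclic words of even length, $|$`cuspSum`$|$ is well defined and invariant
under cancelation. It is at most half the length, with equality for alternating words, where
cancelation stops. Hence the minimal number of remaining cusps is $2|$`cuspSum`$|$
(`reducedCusps_coe`). -/

/-! ### Reduction of cyclic words of cusps -/

/-- The alternating sum of a sequence of cusps, in which only the cusps on the right count. -/
def cuspSum : List Bool → ℤ
  | [] => 0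
  | s :: l => (if s then 1 else 0) - cuspSum l

theorem cuspSum_append (l l' : List Bool) :
    cuspSum (l ++ l') = cuspSum l + (-1) ^ l.length * cuspSum l' := by
  induction l with
  | nil => simp [cuspSum]
  | cons s l ih =>
    simp only [List.cons_append, cuspSum, ih, List.length_cons, pow_succ]
    ring

/-- The two pieces have lengths of equal parity, so exchanging them preserves the alternating sum
(both even) or negates it (both odd). This makes the absolute value a function of the cyclic word.
-/
theorem natAbs_cuspSum_append_comm {l l' : List Bool} (h : Even (l ++ l').length) :
    (cuspSum (l ++ l')).natAbs = (cuspSum (l' ++ l)).natAbs := by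
  rw [List.length_append, Nat.even_add] at h
  rw [cuspSum_append, cuspSum_append]
  rcases Nat.even_or_odd l.length with h1 | h1
  · rw [h1.neg_one_pow, (h.1 h1).neg_one_pow]
    congr 1
    ring
  · have h2 : Odd l'.length := by
      rw [← Nat.not_even_iff_odd] at h1 ⊢
      exact fun h' => h1 (h.2 h')
    rw [h1.neg_one_pow, h2.neg_one_pow, ← Int.natAbs_neg]
    congr 1
    ring

theorem List.IsRotated.natAbs_cuspSum {l l' : List Bool} (h : l ~r l') (hl : Even l.length) :
    (cuspSum l).natAbs = (cuspSum l').natAbs := by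
  obtain ⟨n, hn, rfl⟩ := List.isRotated_iff_mod.1 h
  have h' : l.take n ++ l.drop n = l := List.take_append_drop n l
  rw [List.rotate_eq_drop_append_take hn, ← natAbs_cuspSum_append_comm (by rwa [h']), h']

/-- Two leading letters change the alternating sum by the difference of two numbers in $\{0,1\}$,
hence by at most $1$ in absolute value. This is the lower bound on the number of cusps left by any
cancelation. -/
theorem two_mul_natAbs_cuspSum_le : ∀ l : List Bool, Even l.length →
    2 * (cuspSum l).natAbs ≤ l.length
  | [], _ => by simp [cuspSum]
  | [_], h => by simp at h
  | s :: t :: l, h => by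
    have ih := two_mul_natAbs_cuspSum_le l (by simpa [Nat.even_add_one] using h)
    simp only [cuspSum, List.length_cons]
    split_ifs <;> omega

/-- In an alternating word the right cusps occupy positions of one parity, so they all count with
the same sign, and they are half of the letters. The bound of `two_mul_natAbs_cuspSum_le` is
attained. -/
theorem two_mul_cuspSum_of_isChain : ∀ (l : List Bool) (s : Bool), (s :: l).IsChain (· ≠ ·) →
    Odd l.length → 2 * cuspSum (s :: l) = (if s then 1 else -1) * (s :: l).length
  | [], _, _, h => by simp at h
  | [t], s, hc, _ => by
    cases s <;> cases t <;> simp_all [cuspSum]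
  | t :: s' :: l, s, hc, h => by
    rw [List.isChain_cons_cons, List.isChain_cons_cons] at hc
    obtain ⟨h1, h2, hc⟩ := hc
    obtain rfl : s' = s := by
      cases s <;> cases t <;> cases s' <;> simp_all
    have ih := two_mul_cuspSum_of_isChain l s' hc (by
      rw [List.length_cons, List.length_cons] at h
      rw [← Nat.not_even_iff_odd] at h ⊢
      simpa [Nat.even_add_one] using h)
    rw [cuspSum, cuspSum, mul_sub, mul_sub, ih]
    cases s' <;> cases t <;> simp_all <;> ring

theorem isChain_ne_or_exists_append (l : List Bool) :
    l.IsChain (· ≠ ·) ∨ ∃ (l₁ l₂ : List Bool) (s : Bool), l = l₁ ++ s :: s :: l₂ := by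
  induction l with
  | nil => exact Or.inl List.isChain_nil
  | cons s l ih =>
    rcases ih with h | ⟨l₁, l₂, t, rfl⟩
    · cases l with
      | nil => exact Or.inl (List.isChain_singleton s)
      | cons t l =>
        by_cases hst : s = t
        · subst hst
          exact Or.inr ⟨[], l, s, rfl⟩
        · exact Or.inl (List.isChain_cons_cons.2 ⟨hst, h⟩)
    · exact Or.inr ⟨s :: l₁, l₂, t, rfl⟩

theorem exists_cuspCancel_chain (n : ℕ) : ∀ l : List Bool, l.length = n → Even l.length →
    ∃ c, Relation.ReflTransGen CuspCancel (l : Cycle Bool) c ∧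
      c.length = 2 * (cuspSum l).natAbs := by
  induction n using Nat.strong_induction_on with
  | _ n ih =>
    rintro l rfl hl
    rcases isChain_ne_or_exists_append l with h | ⟨l₁, l₂, s, rfl⟩
    · refine ⟨l, Relation.ReflTransGen.refl, ?_⟩
      cases l with
      | nil => rfl
      | cons s l =>
        have h' := two_mul_cuspSum_of_isChain l s h (by
          rw [← Nat.not_even_iff_odd]
          simpa [Nat.even_add_one] using hl)
        rw [Cycle.length_coe]
        cases s <;> simp only [if_true, if_false, Bool.false_eq_true] at h' <;> omega
    · have hlen : Even (l₂ ++ l₁).length := by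
        simp only [List.length_append, List.length_cons] at hl ⊢
        rw [show l₁.length + (l₂.length + 1 + 1) = l₂.length + l₁.length + 2 by ring] at hl
        simpa [Nat.even_add] using hl
      obtain ⟨c, hc, hcl⟩ := ih (l₂ ++ l₁).length (by simp; omega) _ rfl hlen
      -- `CuspCancel` removes a pair at the start of a representative, so the word is rotated until
      -- the equal pair comes first; what remains is `l₂ ++ l₁`.
      refine ⟨c, Relation.ReflTransGen.head ⟨s, l₂ ++ l₁, ?_, rfl⟩ hc, ?_⟩
      · exact Cycle.coe_eq_coe.2 List.isRotated_append
      · rw [hcl, natAbs_cuspSum_append_comm hl]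
        simp [cuspSum]

/-- Removing an equal pair changes nothing because $x-(x-y)=y$, and rotation preserves the absolute
value in even length. Parity must be carried along for the latter. -/
theorem CuspCancel.exists_list {l : List Bool} {c : Cycle Bool}
    (h : Relation.ReflTransGen CuspCancel l c) (hl : Even l.length) :
    ∃ l' : List Bool, c = l' ∧ Even l'.length ∧ (cuspSum l').natAbs = (cuspSum l).natAbs := by
  induction h with
  | refl => exact ⟨l, rfl, hl, rfl⟩
  | tail _ h ih =>
    obtain ⟨l', rfl, hl', hs⟩ := ih
    obtain ⟨s, l'', h1, rfl⟩ := h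
    have hr := Cycle.coe_eq_coe.1 h1
    refine ⟨l'', rfl, ?_, ?_⟩
    · have := hr.perm.length_eq ▸ hl'
      simpa [Nat.even_add_one] using this
    · rw [← hs, hr.natAbs_cuspSum hl']
      simp [cuspSum]

theorem reducedCusps_coe {l : List Bool} (hl : Even l.length) :
    reducedCusps (l : Cycle Bool) = 2 * (cuspSum l).natAbs := by
  obtain ⟨c, hc, hcl⟩ := exists_cuspCancel_chain _ l rfl hl
  apply le_antisymm
  · exact Nat.sInf_le ⟨c, hc, hcl⟩
  · refine le_csInf ⟨_, c, hc, hcl⟩ ?_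
    rintro n ⟨c', hc', rfl⟩
    obtain ⟨l', rfl, hl', hs⟩ := CuspCancel.exists_list hc' hl
    rw [← hs]
    exact two_mul_natAbs_cuspSum_le l' hl'

namespace RibbonGraph

variable {Γ : RibbonGraph}

/-! ### Crossing numbers along closed walks -/

/-- The total outflow of `a` along the half-edges that precede `d` at its vertex. -/
def outflowBefore (a : Γ.E → ℤ) (d : Γ.Dart) : ℤ :=
  ∑ i ∈ Finset.Iio d.2, outflow a ⟨d.1, i⟩

/-- Exchanging the order of summation groups the crossings by the half-edge of `b`, which allows `b`
to be followed along a walk. -/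
theorem crossingNumber_eq_sum_outflowBefore (a b : Γ.E → ℤ) :
    crossingNumber a b =
      ∑ d : Γ.Dart, outflowBefore a d * outflow b d + ∑ e : Γ.E, a e * b e := by
  rw [crossingNumber, Fintype.sum_sigma]
  congr 1
  refine Finset.sum_congr rfl fun v _ => ?_
  simp only [outflowBefore, Finset.sum_mul]
  exact Finset.sum_comm' (by simp)

theorem outflow_dartChain (d d' : Γ.Dart) : outflow (dartChain d) d' =
    (if d' = d then 1 else 0) - (if d' = flip d then 1 else 0) := by
  obtain ⟨⟨e, s⟩, rfl⟩ := Γ.ends.surjective d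
  obtain ⟨⟨e', s'⟩, rfl⟩ := Γ.ends.surjective d'
  by_cases h : e' = e <;> cases s <;> cases s' <;>
    simp [outflow, dartChain, edge, IsOut, flip, Pi.single_apply, h]

theorem crossingNumber_dartChain (a : Γ.E → ℤ) (d : Γ.Dart) :
    crossingNumber a (dartChain d) =
      outflowBefore a d + outflow a d - outflowBefore a (flip d) := by
  have h : ∑ e : Γ.E, a e * dartChain d e = outflow a d := by
    rw [Finset.sum_eq_single (edge d)]
    · simp only [dartChain, Pi.single_eq_same, outflow]
      split_ifs <;> ring
    · intro e _ he
      simp [dartChain, he]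
    · simp
  rw [crossingNumber_eq_sum_outflowBefore, h]
  simp only [outflow_dartChain, mul_sub, Finset.sum_sub_distrib, mul_ite, mul_one, mul_zero,
    Finset.sum_ite_eq', Finset.mem_univ, if_true]
  ring

/-- The contribution to the crossing number with `a` of a walk that arrives at a vertex by the
half-edge `d` and leaves it by the half-edge `d'`. -/
def turn (a : Γ.E → ℤ) (d d' : Γ.Dart) : ℤ :=
  outflowBefore a d' + outflow a d' - outflowBefore a d

/-- Each edge contributes one term at its start and one at its end. Regrouping them by vertex leaves
a correction at the two ends of the walk, which vanishes when the walk closes. -/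
theorem crossingNumber_travelChain (a : Γ.E → ℤ) (p : Γ.Dart → Γ.Dart) (d : Γ.Dart) :
    crossingNumber a (travelChain p d) =
      ((travel p d).map fun x => turn a (flip x) (p (flip x))).sum := by
  have h : ∀ n : ℕ, crossingNumber a
      (((List.range n).map fun k => dartChain ((walk p)^[k] d)).sum) =
      outflowBefore a d + outflow a d -
        (outflowBefore a ((walk p)^[n] d) + outflow a ((walk p)^[n] d)) +
      ((List.range n).map fun k =>
        turn a (flip ((walk p)^[k] d)) (p (flip ((walk p)^[k] d)))).sum := by
    intro n
    induction n with
    | zero => simpa using crossingNumber_smul_right 0 a 0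
    | succ n ih =>
      rw [List.range_succ]
      simp only [List.map_append, List.sum_append, List.map_cons, List.map_nil, List.sum_cons,
        List.sum_nil, add_zero]
      rw [crossingNumber_add_right, ih, crossingNumber_dartChain,
        Function.iterate_succ_apply' (walk p) n d, turn]
      simp only [walk]
      ring
  have h' := h (Function.minimalPeriod (walk p) d)
  rw [Function.iterate_minimalPeriod, sub_self, zero_add] at h'
  rw [travelChain, travel, List.map_map, List.map_map]
  exact h'

theorem edge_flip (d : Γ.Dart) : edge (flip d) = edge d := by
  simp [flip, edge]

theorem isOut_flip (d : Γ.Dart) : IsOut (flip d) ↔ ¬ IsOut d := by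
  simp [flip, IsOut]

theorem outflow_flip (a : Γ.E → ℤ) (d : Γ.Dart) : outflow a (flip d) = -outflow a d := by
  unfold outflow
  rw [edge_flip]
  by_cases h : IsOut d <;> simp [h, isOut_flip]

/-- Consecutive half-edges differ in `outflowBefore` by one term; that the total outflow of a cycle
vanishes makes this hold across the arbitrary starting point of the numbering too. -/
theorem turn_rot {a : Γ.E → ℤ} (ha : a ∈ cycles Γ) (d : Γ.Dart) :
    turn a d (rot d) = outflow a d + outflow a (rot d) := by
  obtain ⟨v, i⟩ := d
  have hv := mem_cycles.1 ha v
  unfold turn outflowBefore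
  change (∑ j ∈ Finset.Iio (finRotate (Γ.deg v) i), outflow a ⟨v, j⟩) +
    outflow a ⟨v, finRotate (Γ.deg v) i⟩ - ∑ j ∈ Finset.Iio i, outflow a ⟨v, j⟩ =
    outflow a ⟨v, i⟩ + outflow a ⟨v, finRotate (Γ.deg v) i⟩
  generalize hu : (fun j => outflow a (⟨v, j⟩ : Γ.Dart)) = u
  have hu' : ∀ j, outflow a (⟨v, j⟩ : Γ.Dart) = u j := fun j => congrFun hu j
  simp only [hu'] at hv ⊢
  clear hu hu'
  revert i u
  generalize Γ.deg v = n
  intro i u hv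
  cases n with
  | zero => exact i.elim0
  | succ m =>
    induction i using Fin.lastCases with
    -- Here `rot` wraps around to the half-edge number `0`, and the outflows before the last
    -- half-edge add up to minus its own.
    | last =>
      have h0 : Finset.Iio (0 : Fin (m + 1)) = ∅ := by
        ext j
        simp
      have h1 : Finset.univ = insert (Fin.last m) (Finset.Iio (Fin.last m)) := by
        ext j
        simp only [Finset.mem_univ, Finset.mem_insert, Finset.mem_Iio, true_iff]
        exact eq_or_lt_of_le (Fin.le_last j)
      rw [h1, Finset.sum_insert (by simp)] at hv
      rw [finRotate_last, h0, Finset.sum_empty]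
      linarith
    | cast j =>
      have h1 : Finset.Iio j.succ = insert j.castSucc (Finset.Iio j.castSucc) := by
        ext i
        simp only [Finset.mem_Iio, Finset.mem_insert, Fin.lt_def, Fin.ext_iff, Fin.val_succ,
          Fin.val_castSucc]
        omega
      rw [finRotate_apply, Fin.coeSucc_eq_succ, h1, Finset.sum_insert (by simp)]
      ring

theorem turn_add_turn (a : Γ.E → ℤ) (d d' : Γ.Dart) :
    turn a d d' + turn a d' d = outflow a d + outflow a d' := by
  unfold turn
  ring

/-- A turn and its reverse together contribute the two outflows, and by `turn_rot` the right turn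
already accounts for all of that. -/
theorem turn_rot_symm {a : Γ.E → ℤ} (ha : a ∈ cycles Γ) (d : Γ.Dart) :
    turn a d (rot.symm d) = 0 := by
  have h1 := turn_rot ha (rot.symm d)
  have h2 := turn_add_turn a d (rot.symm d)
  rw [Equiv.apply_symm_apply] at h1
  linarith

theorem turn_eq_zero_of_forall_ne {a : Γ.E → ℤ} {d d' : Γ.Dart} (hv : d'.1 = d.1) (hne : d' ≠ d)
    (hs : outflow a d + outflow a d' = 0)
    (h0 : ∀ x : Γ.Dart, x.1 = d.1 → x ≠ d → x ≠ d' → outflow a x = 0) : turn a d d' = 0 := by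
  obtain ⟨v, i⟩ := d
  obtain ⟨w, j⟩ := d'
  obtain rfl : w = v := hv
  have hij : j ≠ i := fun h => hne (by rw [h])
  have h0' : ∀ k, k ≠ i → k ≠ j → outflow a (⟨w, k⟩ : Γ.Dart) = 0 := fun k hk hk' =>
    h0 ⟨w, k⟩ rfl (by simpa using hk) (by simpa using hk')
  unfold turn outflowBefore
  dsimp only
  rcases lt_or_gt_of_ne hij with h | h
  · have h1 : ∑ k ∈ Finset.Iio j, outflow a (⟨w, k⟩ : Γ.Dart) = 0 :=
      Finset.sum_eq_zero fun k hk => by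
        rw [Finset.mem_Iio] at hk
        exact h0' k (hk.trans h).ne hk.ne
    have h2 : ∑ k ∈ Finset.Iio i, outflow a (⟨w, k⟩ : Γ.Dart) = outflow a ⟨w, j⟩ :=
      Finset.sum_eq_single_of_mem j (Finset.mem_Iio.2 h) fun k hk hk' =>
        h0' k (Finset.mem_Iio.1 hk).ne hk'
    rw [h1, h2]
    ring
  · have h1 : ∑ k ∈ Finset.Iio i, outflow a (⟨w, k⟩ : Γ.Dart) = 0 :=
      Finset.sum_eq_zero fun k hk => by
        rw [Finset.mem_Iio] at hk
        exact h0' k hk.ne (hk.trans h).ne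
    have h2 : ∑ k ∈ Finset.Iio j, outflow a (⟨w, k⟩ : Γ.Dart) = outflow a ⟨w, i⟩ :=
      Finset.sum_eq_single_of_mem i (Finset.mem_Iio.2 h) fun k hk hk' =>
        h0' k hk' (Finset.mem_Iio.1 hk).ne
    rw [h1, h2]
    linarith

end RibbonGraph

namespace LinkDiagram

open RibbonGraph

variable {F : CellSurface} (D : LinkDiagram F)

/-! ### The `1`-cycle of the link -/

/-- The `1`-chain of the oriented link. -/
def linkChain (e : F.E) : ℤ := if e ∈ D.link then 1 else 0

theorem sum_componentChain : ∑ c : D.Component, D.componentChain c = D.linkChain := by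
  classical
  funext e
  rw [Finset.sum_apply, linkChain]
  have he : edge (F.ends (e, false)) = e := by simp [edge]
  split_ifs with h
  · have h' : edge (F.ends (e, false)) ∈ D.link := by rwa [he]
    let c₀ : D.Component := Quot.mk _ ⟨F.ends (e, false), h'⟩
    rw [Finset.sum_eq_single_of_mem c₀ (Finset.mem_univ _)]
    · exact if_pos ⟨h', rfl⟩
    · rintro c - hc
      refine if_neg ?_
      rintro ⟨_, rfl⟩
      exact hc rfl
  · refine Finset.sum_eq_zero fun c _ => if_neg ?_
    rintro ⟨h', -⟩
    exact h (he ▸ h')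

theorem linkChain_mem : D.linkChain ∈ cycles F.toRibbonGraph := by
  rw [← sum_componentChain]
  exact Submodule.sum_mem _ fun c _ => D.componentChain_mem c

theorem outflow_linkChain {d : F.Dart} (hd : edge d ∈ D.link) :
    outflow D.linkChain d = if IsOut d then 1 else -1 := by
  simp [outflow, linkChain, hd]

theorem outflow_linkChain_of_notMem {d : F.Dart} (hd : edge d ∉ D.link) :
    outflow D.linkChain d = 0 := by
  simp [outflow, linkChain, hd]

theorem intersectionHom_oneLabel {b : F.E → ℤ} (hb : b ∈ cycles F.toRibbonGraph) :
    D.intersectionHom D.oneLabel (Submodule.Quotient.mk ⟨b, hb⟩) =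
      crossingNumber D.linkChain b := by
  have h : ∀ c : D.Component, F.intersectionForm (D.componentClass c)
      (Submodule.Quotient.mk ⟨b, hb⟩) = crossingForm F.toRibbonGraph (D.componentChain c) b :=
    fun c => rfl
  change _ = crossingForm F.toRibbonGraph D.linkChain b
  rw [← sum_componentChain, map_sum, LinearMap.sum_apply]
  simp only [intersectionHom, oneLabel, smul_eq_mul, mul_one, h]

/-! ### Smoothings -/

/-- Used twice: all four half-edges at a crossing lie on the link, and the left and right neighbors
of a half-edge are distinct, so the side of a cusp is unambiguous. -/
theorem rot_rot_ne {d : F.Dart} (hd : d.1 ∈ D.crossings) : rot (rot d) ≠ d := by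
  obtain ⟨v, i⟩ := d
  have h4 := D.deg_crossing v hd
  intro h
  have h' : finRotate (F.deg v) (finRotate (F.deg v) i) = i := by
    simpa [rot] using h
  clear h hd
  revert h' i
  rw [h4]
  decide

theorem edge_mem_of_mem_crossings {d : F.Dart} (hd : d.1 ∈ D.crossings) : edge d ∈ D.link := by
  rw [← D.opp_ne_iff, D.opp_crossing d hd]
  exact D.rot_rot_ne hd

variable {D}

theorem State.edge_joined_mem (S : D.State) {d : F.Dart} (hd : edge d ∈ D.link) :
    edge (S.joined d) ∈ D.link := by
  by_cases hc : d.1 ∈ D.crossings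
  · exact D.edge_mem_of_mem_crossings (by rwa [S.joined_vertex])
  · rw [State.joined, dif_neg hc, ← D.opp_ne_iff, D.opp_opp]
    exact ((D.opp_ne_iff d).2 hd).symm

theorem State.joined_eq_or_eq (S : D.State) {d : F.Dart} (hd : d.1 ∈ D.crossings) :
    S.joined d = rot d ∨ S.joined d = rot.symm d := by
  unfold State.joined
  split_ifs <;> simp

/-- Without a cusp one half-edge points in and the other out, so the outflow changes sign; at a cusp
it does not. -/
theorem State.outflow_joined (S : D.State) {d : F.Dart} (hd : edge d ∈ D.link) :
    outflow D.linkChain (S.joined d) =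
      -((-1) ^ (S.cuspAt d).toList.length * outflow D.linkChain d) := by
  rw [D.outflow_linkChain hd, D.outflow_linkChain (S.edge_joined_mem hd), State.cuspAt]
  by_cases hc : d.1 ∈ D.crossings
  · by_cases h1 : IsOut d <;> by_cases h2 : IsOut (S.joined d) <;> simp [hc, h1, h2]
  · have h : IsOut (S.joined d) ↔ ¬ IsOut d := by
      rw [State.joined, dif_neg hc]
      exact D.opp_isOut d hd
    by_cases h1 : IsOut d <;> simp [hc, h, h1]

theorem State.turn_joined (S : D.State) {d : F.Dart} (hd : edge d ∈ D.link) :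
    turn D.linkChain d (S.joined d) =
      2 * outflow D.linkChain d * cuspSum (S.cuspAt d).toList := by
  by_cases hc : d.1 ∈ D.crossings
  · rcases S.joined_eq_or_eq hc with h | h
    · have ho := S.outflow_joined hd
      rw [h] at ho ⊢
      rw [turn_rot D.linkChain_mem, ho]
      unfold State.cuspAt
      rw [h]
      split_ifs
      · simp [cuspSum]
        ring
      · simp [cuspSum]
    -- A left turn contributes nothing, and a cusp there is recorded as `false`, which has weight
    -- $0$ in `cuspSum`.
    · have hne : rot.symm d ≠ rot d := fun h' => by
        rw [Equiv.symm_apply_eq] at h'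
        exact D.rot_rot_ne hc h'.symm
      rw [h, turn_rot_symm D.linkChain_mem]
      unfold State.cuspAt
      rw [h]
      split_ifs <;> simp [cuspSum, hne]
  · have ho := S.outflow_joined hd
    have hcusp : S.cuspAt d = none := if_neg fun h => hc h.1
    have hj : S.joined d = D.opp d := dif_neg hc
    rw [hcusp, hj] at ho
    rw [hcusp, hj, turn_eq_zero_of_forall_ne (D.opp_vertex d) ((D.opp_ne_iff d).2 hd)]
    · simp [cuspSum]
    · rw [ho]
      simp
    · intro x hx h1 h2
      refine D.outflow_linkChain_of_notMem fun hxl => ?_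
      exact (D.eq_or_eq_opp d x hc hx hd hxl).elim h1 h2

/-! ### Loops -/

/-- The outflow sign after `n` steps is exactly the sign with which `cuspSum` weights the next cusp,
so the claims are proved jointly. The minus sign in the last one arises because a turn is measured
at the arriving half-edge `flip x`. -/
theorem State.iterate_walk (S : D.State) {d : F.Dart} (hd : edge d ∈ D.link) (n : ℕ) :
    edge ((walk S.joined)^[n] d) ∈ D.link ∧
    outflow D.linkChain ((walk S.joined)^[n] d) =
      (-1) ^ (((List.range n).map fun k => (walk S.joined)^[k] d).filterMap
        fun x => S.cuspAt (flip x)).length * outflow D.linkChain d ∧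
    (((List.range n).map fun k => (walk S.joined)^[k] d).map fun x =>
      turn D.linkChain (flip x) (S.joined (flip x))).sum =
      -(2 * outflow D.linkChain d * cuspSum (((List.range n).map fun k =>
        (walk S.joined)^[k] d).filterMap fun x => S.cuspAt (flip x))) := by
  induction n with
  | zero => simpa [cuspSum] using hd
  | succ n ih =>
    obtain ⟨h1, h2, h3⟩ := ih
    rw [Function.iterate_succ_apply' (walk S.joined) n d, List.range_succ]
    simp only [List.map_append, List.filterMap_append, List.sum_append, List.map_cons,
      List.map_nil, List.sum_cons, List.sum_nil, add_zero, List.length_append]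
    generalize (walk S.joined)^[n] d = x at *
    have hx : edge (flip x) ∈ D.link := by rwa [edge_flip]
    have hl : List.filterMap (fun x => S.cuspAt (flip x)) [x] =
        (S.cuspAt (flip x)).toList := by
      cases h : S.cuspAt (flip x) <;> simp [h]
    rw [hl, cuspSum_append, h3, S.turn_joined hx]
    refine ⟨S.edge_joined_mem hx, ?_, ?_⟩
    · rw [walk, S.outflow_joined hx, outflow_flip, h2]
      ring
    · rw [outflow_flip, h2]
      ring

theorem State.edge_start_mem (S : D.State) (C : S.Loop) : edge (S.start C) ∈ D.link :=
  (Quot.out C).2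

/-- The number of cusps that remain on a loop is, up to sign, its intersection number with the
link. -/
theorem State.natAbs_intersectionHom (S : D.State) (C : S.Loop) :
    (D.intersectionHom D.oneLabel (S.loopClass C)).natAbs = reducedCusps (S.cusps C) ∧
      Even (reducedCusps (S.cusps C)) := by
  have hd := S.edge_start_mem C
  obtain ⟨-, h2, h3⟩ := S.iterate_walk hd (Function.minimalPeriod (walk S.joined) (S.start C))
  rw [Function.iterate_minimalPeriod] at h2
  have ho : outflow D.linkChain (S.start C) = 1 ∨ outflow D.linkChain (S.start C) = -1 := by
    rw [D.outflow_linkChain hd]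
    split_ifs <;> simp
  have hlen : Even ((travel S.joined (S.start C)).filterMap
      fun x => S.cuspAt (flip x)).length := by
    -- After a full period the walk is back at its start, but an odd number of cusps would negate
    -- the nonzero outflow there.
    by_contra hodd
    rw [Nat.not_even_iff_odd] at hodd
    rw [travel] at hodd
    rw [hodd.neg_one_pow] at h2
    omega
  rw [State.loopClass, intersectionHom_oneLabel, crossingNumber_travelChain, State.cusps,
    reducedCusps_coe hlen]
  refine ⟨?_, even_two_mul _⟩
  rw [travel, h3]
  rcases ho with ho | ho <;> rw [ho] <;> simp [Int.natAbs_mul]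

end LinkDiagram

/-! ### Comparison of the two state sums -/

theorem halfSubst_varX (u : ℕ → ArrowRing) (n : ℤ) : halfSubst u (varX n) = halfValue u n := by
  change MvPolynomial.aeval _ (MvPolynomial.X _) = _
  rw [MvPolynomial.aeval_X]
  rfl

theorem mainTheorem3 (F : CellSurface) (D : LinkDiagram F) (hD : D.link.Nonempty) :
    (∀ (S : D.State) (C : S.Loop), Even (D.intersectionHom D.oneLabel (S.loopClass C)) ∧
      Even (reducedCusps (S.cusps C))) ∧
    ∀ u : ℕ → ArrowRing,
      loopValue • D.arrowPoly = halfSubst u (D.homArrowPoly D.oneLabel) := by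
  have hEven : ∀ (S : D.State) (C : S.Loop),
      Even (D.intersectionHom D.oneLabel (S.loopClass C)) := fun S C => by
    rw [← Int.natAbs_even, (S.natAbs_intersectionHom C).1]
    exact (S.natAbs_intersectionHom C).2
  refine ⟨fun S C => ⟨hEven S C, (S.natAbs_intersectionHom C).2⟩, fun u => ?_⟩
  rw [LinkDiagram.arrowPoly, LinkDiagram.homArrowPoly, map_sum, Finset.smul_sum]
  refine Finset.sum_congr rfl fun S _ => ?_
  -- A nonempty link gives every state a loop, so the natural-number exponent `Fintype.card S.Loop -
  -- 1` is not truncated.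
  have hcard : 0 < Fintype.card S.Loop := by
    obtain ⟨e, he⟩ := hD
    have he' : RibbonGraph.edge (F.ends (e, false)) ∈ D.link := by simpa [RibbonGraph.edge] using he
    exact Fintype.card_pos_iff.2 ⟨Quot.mk _ ⟨F.ends (e, false), he'⟩⟩
  have hC : ∀ C : S.Loop, halfSubst u
      (loopValue • varX (D.intersectionHom D.oneLabel (S.loopClass C))) =
      loopValue • varK (reducedCusps (S.cusps C) / 2) := fun C => by
    rw [map_smul, halfSubst_varX, halfValue, if_pos (hEven S C),
      (S.natAbs_intersectionHom C).1]
  rw [map_smul, map_prod, Finset.prod_congr rfl fun C _ => hC C, Finset.prod_smul,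
    Finset.prod_const, Finset.card_univ, smul_smul, smul_smul]
  congr 1
  rw [mul_left_comm, ← pow_succ', Nat.sub_add_cancel hcard]
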